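/- A P-finite automaton of dimension $n$ over a finite alphabet $\Sigma$ is a triple $\mathcal A=(\alpha,\mu,\beta)$ with $\alpha\in\mathbb Q^{1\times n}$, $\mu:\Sigma\to\mathbb Q[x]^{n\times n}$ and $\beta\in\mathbb Q[x]^{n\times 1}$. It computes $f_{\mathcal A}(\sigma_1\cdots\sigma_k)=\alpha\,\mu(\sigma_1)(1)\cdots\mu(\sigma_k)(k)\,\beta(k+1)$. Fix a target function $f:\Sigma^*\to\mathbb Q$. For finite sequences of words $R=[r_1,\dots,r_m]$ and $C=[c_1,\dots,c_p]$ let $H(R,C)=(f(r_ic_j))_{i,j}$, let $\Delta=\mathrm{diag}(|r_1|+1,\dots,|r_m|+1)$, and let $H_e(R,C)=[\Delta^0H(R,C)\mid\cdots\mid\Delta^{e}H(R,C)]$. The procedure $\mathtt{partial\_learner}(d,\ell,R,C)$ runs as follows. 1. If $\ell<|C|$, return None. Otherwise put $p=|C|$ and $e=d(p+1)p$. 2. For every $\sigma\in\Sigma$ pick a solution $Y^\sigma$ of $H_e(R,C)\,Y=H(R,[\sigma c_1,\dots,\sigma c_p])$, and build the hypothesis $\mathcal H=(e_1^{\top}H(R,C),\mu,e_1)$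 with $\mu(\sigma)_{ij}=\sum_{k=0}^{e}Y^\sigma_{i+kp,\,j}\,x^k$. If one of the systems is unsolvable, the run stops without returning a value. 3. Ask the teacher whether $f_{\mathcal H}=f$. If so, return $\mathcal H$. Otherwise the teacher gives some word $w$ with $f_{\mathcal H}(w)\ne f(w)$. 4. Let $u\sigma$ be the shortest non-empty prefix of $w$ on which $\mathcal H$ is incorrect, that is, such that the row vector of $\mathcal H$ after reading $u\sigma$ differs from $(f(u\sigma c_1),\dots,f(u\sigma c_p))$, and let $c$ be the first $c_j$ for which the $j$-th entries differ. 5. Call $\mathtt{partial\_learner}(d,\ell,R\cdot[u],C)$ if $H_e(R\cdot[u],C)$ has rank $|R|+1$, and $\mathtt{partial\_learner}(d,\ell,R\cdot[u],C\cdot[\sigma c])$ otherwise. **Proposition.** Let $f=f_{\mathcal A}$, where the target $\mathcal A$ is a P-finite automaton of dimension $n$ and $d_{\max}$ is the maximal degree of the polynomials in $\mu$ and $\beta$. Let $L(y_1,y_2)=((y_1+1)y_2^2)^{y_2}$ (with $0^0=1$), and let $n'\ge n$ and $d\ge d_{\max}$. Consider the runs of $\mathtt{partial\_learner}(d,L(d,n'),[\varepsilon],[\varepsilon])$,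 for all choices of solutions in step 2 and of counterexamples in step 3. (i) No run returns None. (ii) Every call $\mathtt{partial\_learner}(d,L(d,n'),R,C)$ made in a run satisfies $|C|\le L(d,n')$. (iii) If $f(\varepsilon)\neq0$ or $f$ is identically zero, then moreover every run terminates by returning a value: there is no infinite sequence of recursive calls, the systems in step 2 are solvable in every call that is reached, and step 4 finds $(u,\sigma,c)$ for every counterexample. Moreover some run returns an automaton. Hence, by (i) and step 3, every run returns an automaton that computes $f$. -/

import Mathlib

open Polynomial

/-- A P-finite automaton of dimension `n` over the alphabet `α`: an initial row vector over `ℚ`,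
a transition matrix over `ℚ[X]` for each letter, and a final column vector over `ℚ[X]`. -/
structure PFiniteAutomaton (α : Type*) (n : ℕ) where
  init : Fin n → ℚ
  trans : α → Matrix (Fin n) (Fin n) ℚ[X]
  final : Fin n → ℚ[X]

namespace PFiniteAutomaton

variable {α : Type*} {n : ℕ}

/-- The rational matrix `μ(a, k)`: the transition matrix of `a` evaluated at `k`. -/
noncomputable def transAt (A : PFiniteAutomaton α n) (a : α) (k : ℕ) :
    Matrix (Fin n) (Fin n) ℚ :=
  (A.trans a).map (fun p => p.eval (k : ℚ))

/-- The product `μ(a₁, k) μ(a₂, k + 1) ⋯ μ(aₘ, k + m - 1)` for the word `a₁ a₂ ⋯ aₘ`. -/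
noncomputable def transWordAt (A : PFiniteAutomaton α n) :
    List α → ℕ → Matrix (Fin n) (Fin n) ℚ
  | [], _ => 1
  | a :: w, k => A.transAt a k * A.transWordAt w (k + 1)

/-- The function computed by the automaton, `w ↦ init · μ(w, 1) · final(|w| + 1)`. -/
noncomputable def sem (A : PFiniteAutomaton α n) (w : List α) : ℚ :=
  dotProduct (Matrix.vecMul A.init (A.transWordAt w 1))
    (fun i => (A.final i).eval ((w.length + 1 : ℕ) : ℚ))

/-- The maximal degree of the polynomials occurring in the transition matrices and in the final
vector (zero polynomials are counted with degree `0`). -/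
noncomputable def maxDegree [Fintype α] (A : PFiniteAutomaton α n) : ℕ :=
  max
    (Finset.univ.sup fun a : α => Finset.univ.sup fun i : Fin n =>
      Finset.univ.sup fun j : Fin n => (A.trans a i j).natDegree)
    (Finset.univ.sup fun i : Fin n => (A.final i).natDegree)

end PFiniteAutomaton

namespace PFiniteLearning

variable {α : Type*}

/-- The first vector of the standard basis. -/
def e₁ (m : ℕ) : Fin m → ℚ := fun i => if i.val = 0 then 1 else 0

/-- The table `H(R, C)`: the entry in row `r` and column `c` is `f (r c)`. -/
def table (f : List α → ℚ) (R C : List (List α)) : Matrix (Fin R.length) (Fin C.length) ℚ :=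
  Matrix.of fun i j => f (R.get i ++ C.get j)

/-- The table `H(R, [a c₁, …, a cₙ])`, where `C = [c₁, …, cₙ]`. -/
def shiftedTable (f : List α → ℚ) (R C : List (List α)) (a : α) :
    Matrix (Fin R.length) (Fin C.length) ℚ :=
  Matrix.of fun i j => f (R.get i ++ a :: C.get j)

/-- The block matrix `[Δ⁰ H | Δ¹ H | ⋯ | Δᵈ H]` with `H = H(R, C)` and
`Δ = diag(|r₁| + 1, …, |rₘ| + 1)`. The column `(k, j)` is the `j`-th column of the block `Δᵏ H`. -/
def extendedTable (f : List α → ℚ) (d : ℕ) (R C : List (List α)) :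
    Matrix (Fin R.length) (Fin (d + 1) × Fin C.length) ℚ :=
  Matrix.of fun i kj =>
    (((R.get i).length + 1 : ℕ) : ℚ) ^ (kj.1 : ℕ) * table f R C i kj.2

/-- The automaton `(e₁ᵀ H, μ, e₁)` assembled from coefficient matrices `Y a`, where
`μ(a)ᵢⱼ = ∑ₖ (Y a)₍ₖ,ᵢ₎ⱼ xᵏ`. -/
noncomputable def assemble (f : List α → ℚ) (d : ℕ) (R C : List (List α))
    (Y : α → Matrix (Fin (d + 1) × Fin C.length) (Fin C.length) ℚ) :
    PFiniteAutomaton α C.length where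
  init := Matrix.vecMul (e₁ R.length) (table f R C)
  trans := fun a => Matrix.of fun i j =>
    ∑ k : Fin (d + 1), Polynomial.C (Y a (k, i) j) * Polynomial.X ^ (k : ℕ)
  final := fun i => Polynomial.C (e₁ C.length i)

/-- `A` is a possible output of the hypothesis builder on `d, R, C`: for each letter `a` a solution
`Y a` of the linear system `[Δ⁰ H | ⋯ | Δᵈ H] Y = H(R, [a c₁, …, a cₙ])` is picked, and `A` is
assembled from these solutions. The builder has no output if one of the systems is unsolvable. -/
def IsHypothesis (f : List α → ℚ) (d : ℕ) (R C : List (List α))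
    (A : PFiniteAutomaton α C.length) : Prop :=
  ∃ Y : α → Matrix (Fin (d + 1) × Fin C.length) (Fin C.length) ℚ,
    (∀ a : α, extendedTable f d R C * Y a = shiftedTable f R C a) ∧ A = assemble f d R C Y

/-- The loop of `largestCorrectPrefix`: `u` is the part of the word read so far, the last argument
is the part still to be read, and `x` is the current vector `init · μ(u, 1)`. -/
noncomputable def largestCorrectPrefixLoop (f : List α → ℚ) (C : List (List α))
    (A : PFiniteAutomaton α C.length) :
    (Fin C.length → ℚ) → List α → List α → Option (List α × α × List α)
  | _, _, [] => none
  | x, u, a :: w =>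
    match (List.finRange C.length).find? (fun j =>
        decide (Matrix.vecMul x (A.transAt a (u.length + 1)) j ≠ f (u ++ a :: C.get j))) with
    | some j => some (u, a, C.get j)
    | none =>
      largestCorrectPrefixLoop f C A (Matrix.vecMul x (A.transAt a (u.length + 1))) (u ++ [a]) w

/-- The procedure that reads `w` letter by letter and returns `(u, a, c)` for the first prefix `u a`
on which the hypothesis is incorrect, with `c` the first column that shows it. -/
noncomputable def largestCorrectPrefix (f : List α → ℚ) (C : List (List α))
    (A : PFiniteAutomaton α C.length) (w : List α) : Option (List α × α × List α) :=
  largestCorrectPrefixLoop f C A A.init [] w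

/-- The arguments that vary over the recursive calls of the partial learner: the rows `R` and the
columns `C` of the table. -/
structure Args (α : Type*) where
  R : List (List α)
  C : List (List α)

/-- The initial arguments `[ε], [ε]`. -/
def Args.start (α : Type*) : Args α := ⟨[[]], [[]]⟩

/-- The degree bound `d (|C| + 1) |C|` that the partial learner uses for its hypotheses. -/
def Args.degree (d : ℕ) (T : Args α) : ℕ := d * (T.C.length + 1) * T.C.length

/-- The new arguments after `(u, a, c)` has been extracted from a counterexample: the row `u` is
added, and the column `a c` is added unless the extended table with the new row has rank
`|R| + 1`. -/
noncomputable def Args.update (f : List α → ℚ) (d : ℕ) (T : Args α)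
    (u : List α) (a : α) (c : List α) : Args α :=
  ⟨T.R ++ [u],
    if (extendedTable f (T.degree d) (T.R ++ [u]) T.C).rank = T.R.length + 1 then T.C
    else T.C ++ [a :: c]⟩

/-- In the call of the partial learner with arguments `d, ℓ, T`, if the hypothesis is `A` and the
teacher answers the equivalence query on `A` with the counterexample `w`, then the partial learner
is called recursively with arguments `d, ℓ, T'`. -/
def RecursiveCallOn (f : List α → ℚ) (d ℓ : ℕ) (T : Args α)
    (A : PFiniteAutomaton α T.C.length) (w : List α) (T' : Args α) : Prop :=
  ¬ ℓ < T.C.length ∧ IsHypothesis f (T.degree d) T.R T.C A ∧ A.sem w ≠ f w ∧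
    ∃ u a c, largestCorrectPrefix f T.C A w = some (u, a, c) ∧ T' = T.update f d u a c

/-- The call of the partial learner with arguments `d, ℓ, T` can make the recursive call with
arguments `d, ℓ, T'`. -/
def RecursiveCall (f : List α → ℚ) (d ℓ : ℕ) (T T' : Args α) : Prop :=
  ∃ A w, RecursiveCallOn f d ℓ T A w T'

/-- `Returns f d ℓ T res`: with a teacher for `f`, some run of the partial learner on the arguments
`d, ℓ, T` returns `res`. The choices that a run leaves open are the teacher's counterexamples and
the solutions of the linear systems picked by the hypothesis builder. -/
inductive Returns (f : List α → ℚ) (d ℓ : ℕ) :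
    Args α → Option (Σ m : ℕ, PFiniteAutomaton α m) → Prop
  | timeout (T : Args α) (h : ℓ < T.C.length) : Returns f d ℓ T none
  | found (T : Args α) (A : PFiniteAutomaton α T.C.length) (h : ¬ ℓ < T.C.length)
      (hA : IsHypothesis f (T.degree d) T.R T.C A) (heq : ∀ w, A.sem w = f w) :
      Returns f d ℓ T (some ⟨T.C.length, A⟩)
  | recurse (T T' : Args α) (res : Option (Σ m : ℕ, PFiniteAutomaton α m))
      (h : RecursiveCall f d ℓ T T') (hres : Returns f d ℓ T' res) : Returns f d ℓ T res

/-- `Reachable f d ℓ T T'`: the arguments `d, ℓ, T'` occur in some run of the partial learner that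
starts with the arguments `d, ℓ, T`. -/
def Reachable (f : List α → ℚ) (d ℓ : ℕ) : Args α → Args α → Prop :=
  Relation.ReflTransGen (RecursiveCall f d ℓ)

/-- Every run of the partial learner on the arguments `d, ℓ, T` comes to an end by returning a
value: there is no infinite sequence of recursive calls, and at each call that does not time out
the hypothesis builder has an output and every possible counterexample leads to a recursive call. -/
def EveryRunReturns (f : List α → ℚ) (d ℓ : ℕ) (T : Args α) : Prop :=
  Acc (fun T₂ T₁ => RecursiveCall f d ℓ T₁ T₂) T ∧
    ∀ T', Reachable f d ℓ T T' → ¬ ℓ < T'.C.length →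
      (∃ A, IsHypothesis f (T'.degree d) T'.R T'.C A) ∧
      ∀ A w, IsHypothesis f (T'.degree d) T'.R T'.C A → A.sem w ≠ f w →
        ∃ T'', RecursiveCallOn f d ℓ T' A w T''

/-- The column bound `L(y₁, y₂) = ((y₁ + 1) y₂²) ^ y₂`. -/
def columnBound (y₁ y₂ : ℕ) : ℕ := ((y₁ + 1) * y₂ ^ 2) ^ y₂

end PFiniteLearning

/-! Reading a word `c` backwards from the final vector gives a polynomial vector `b_c` of degree at
most `d (|c| + 1)`, and `f(r c)` is the product of the forward vector of `r` with `b_c(|r| + 1)`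
(`sem_append`, `natDegree_backVec_le`). If `b_{σc}` lies in the `ℚ[X]`-span of the vectors of the
present columns, its coefficients can be chosen of degree at most `e = d (p + 1) p`
(`exists_combination_natDegree_le`). So one vector `y` expresses the column `σc` through the
extended table, at every row. The hypothesis uses another vector, correct on `R` but wrong at `u`;
the difference of the two annihilates the rows of `R` but not the row of `u`. If the old rows are
independent, the rank therefore grows and no column is added.

Hence each added column strictly enlarges the module spanned by the `b_c`. The `i`-th column,
counted from 0, has length at most `i`, so generator degrees grow linearly, and comparing dimensions
in low degree bounds the chain by `L(d, n)` (`chain_length_le`). This gives (i) and (ii).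

If `f(ε) ≠ 0`, the rows stay independent. Then the systems are solvable, and the number of rows is
bounded by that of the extended columns, which forces termination. If `f = 0`, every hypothesis at
the first query is already correct. -/

namespace PFiniteLearning

/-! ### Nonvanishing minors of maximal size -/

section Minor

open Module Submodule

/-- Row rank equals column rank: a basis chosen from the family has equally many independent
coordinates. A combination of the basis vanishing at these coordinates has its coefficients in the
kernel of the invertible minor. -/
theorem exists_minor_det_ne_zero_of_field {K : Type*} [Field K] {ι : Type*} {n : ℕ}
    (V : ι → Fin n → K) :
    ∃ (I : Fin (finrank K (span K (Set.range V))) → ι)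
      (J : Fin (finrank K (span K (Set.range V))) → Fin n),
      (Matrix.of fun a b => V (I b) (J a)).det ≠ 0 ∧
      ∀ w ∈ span K (Set.range V), (∀ a, w (J a) = 0) → w = 0 := by
  have h0 := exists_fun_fin_finrank_span_eq K (Set.range V)
  generalize finrank K (span K (Set.range V)) = r at *
  obtain ⟨f, hf, hspan, hli⟩ := h0
  choose I hI using hf
  set M : Matrix (Fin r) (Fin n) K := Matrix.of f with hM
  have hrank : finrank K (span K (Set.range M.col)) = r := by
    rw [← Matrix.rank_eq_finrank_span_cols, LinearIndependent.rank_matrix (M := M) hli,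
      Fintype.card_fin]
  have h := exists_fun_fin_finrank_span_eq K (Set.range M.col)
  rw [hrank] at h
  obtain ⟨g, hg, -, hgli⟩ := h
  choose J hJ using hg
  have hdet : (Matrix.of fun a b => V (I b) (J a)).det ≠ 0 := by
    have hu : IsUnit (Matrix.of fun a b => V (I b) (J a)) := by
      rw [← Matrix.linearIndependent_rows_iff_isUnit]
      have hrow : (Matrix.of fun a b => V (I b) (J a)).row = g := by
        funext a
        rw [← hJ a]
        funext b
        simp [Matrix.row, Matrix.col, hM, hI b]
      rwa [hrow]
    exact ((Matrix.isUnit_iff_isUnit_det _).1 hu).ne_zero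
  refine ⟨I, J, hdet, fun w hw hwJ => ?_⟩
  rw [← hspan, mem_span_range_iff_exists_fun] at hw
  obtain ⟨y, rfl⟩ := hw
  have hy : y = 0 := by
    refine Matrix.eq_zero_of_mulVec_eq_zero hdet ?_
    funext a
    have := hwJ a
    simp only [Finset.sum_apply, Pi.smul_apply, smul_eq_mul] at this
    simp only [Matrix.mulVec, dotProduct, Matrix.of_apply, Pi.zero_apply]
    rw [← this]
    exact Finset.sum_congr rfl fun b _ => by rw [hI b, mul_comm]
  simp [hy]

variable {R : Type*} [CommRing R] [IsDomain R] {ι : Type*} {n : ℕ}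

/-- The rank over the field of fractions of a family of vectors over a domain. -/
noncomputable def fracRank (v : ι → Fin n → R) : ℕ :=
  finrank (FractionRing R)
    (span (FractionRing R) (Set.range fun i a => algebraMap R (FractionRing R) (v i a)))

theorem exists_minor_det_ne_zero (v : ι → Fin n → R) :
    ∃ (I : Fin (fracRank v) → ι) (J : Fin (fracRank v) → Fin n),
      (Matrix.of fun a b => v (I b) (J a)).det ≠ 0 ∧
      ∀ w ∈ span R (Set.range v), (∀ a, w (J a) = 0) → w = 0 := by
  obtain ⟨I, J, hdet, hinj⟩ := exists_minor_det_ne_zero_of_field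
    (fun i a => algebraMap R (FractionRing R) (v i a))
  refine ⟨I, J, fun h => hdet ?_, fun w hw hwJ => ?_⟩
  · rw [← map_zero (algebraMap R (FractionRing R)), ← h, RingHom.map_det]
    rfl
  · have hmem : (fun a => algebraMap R (FractionRing R) (w a)) ∈
        span (FractionRing R) (Set.range fun i a => algebraMap R (FractionRing R) (v i a)) := by
      clear hwJ
      induction hw using span_induction with
      | mem x hx =>
        obtain ⟨i, rfl⟩ := hx
        exact subset_span ⟨i, rfl⟩
      | zero => simp [← Pi.zero_def]
      | add x y _ _ hx hy => simpa [← Pi.add_def] using add_mem hx hy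
      | smul c x _ hx =>
        convert smul_mem _ (algebraMap R (FractionRing R) c) hx using 1
        funext a
        simp
    have h0 := hinj _ hmem fun a => by simp [hwJ a]
    funext a
    exact (IsFractionRing.injective R (FractionRing R)) (by simpa using congrFun h0 a)

end Minor

/-! ### Degree bounds for polynomial linear combinations -/

section DegreeBounds

theorem natDegree_det_le {r : ℕ} {M : Matrix (Fin r) (Fin r) ℚ[X]} {D : Fin r → ℕ}
    (h : ∀ a b, (M a b).natDegree ≤ D b) : M.det.natDegree ≤ ∑ b, D b := by
  rw [Matrix.det_apply]
  refine natDegree_sum_le_of_forall_le _ _ fun σ _ => (natDegree_smul_le _ _).trans ?_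
  exact (natDegree_prod_le _ _).trans (Finset.sum_le_sum fun b _ => h _ b)

/-- A vector of degree at most `D` in the span of `p` polynomial vectors of degree at most `D`
is a combination of them with coefficients of degree at most `(p + 1) D`. -/
theorem exists_combination_natDegree_le {p n : ℕ} (v : Fin p → Fin n → ℚ[X])
    (b : Fin n → ℚ[X]) {D E : ℕ} (hDE : D ≤ E) (hv : ∀ i a, (v i a).natDegree ≤ D)
    (hb : ∀ a, (b a).natDegree ≤ E) (hmem : b ∈ Submodule.span ℚ[X] (Set.range v)) :
    ∃ q : Fin p → ℚ[X], (∀ i, (q i).natDegree ≤ p * D + (E - D)) ∧ ∑ i, q i • v i = b := by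
  obtain ⟨I, J, hdet, hinj⟩ := exists_minor_det_ne_zero v
  generalize fracRank v = r at *
  set M := Matrix.of fun a b => v (I b) (J a) with hM
  set δ := M.det with hδ
  have hI : Function.Injective I := by
    intro b b' hbb
    by_contra hne
    exact hdet (Matrix.det_zero_of_column_eq hne fun a => by simp [hM, hbb])
  have hrp : r ≤ p := by simpa using Fintype.card_le_of_injective I hI
  have hδdeg : δ.natDegree ≤ r * D := by
    simpa using natDegree_det_le (M := M) (D := fun _ => D) fun a b => hv _ _
  obtain ⟨s, hs⟩ := (Submodule.mem_span_range_iff_exists_fun _).1 hmem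
  have hvδ : ∀ j, δ • v j = ∑ c, M.cramer (fun a => v j (J a)) c • v (I c) := by
    intro j
    rw [← sub_eq_zero]
    refine hinj _ (sub_mem (Submodule.smul_mem _ _ (Submodule.subset_span ⟨j, rfl⟩))
      (sum_mem fun c _ => Submodule.smul_mem _ _ (Submodule.subset_span ⟨_, rfl⟩))) fun a => ?_
    have := congrFun (Matrix.mulVec_cramer M fun a => v j (J a)) a
    simp only [Matrix.mulVec, dotProduct, Pi.smul_apply, smul_eq_mul] at this
    simp only [Pi.sub_apply, Finset.sum_apply, Pi.smul_apply, smul_eq_mul, hδ]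
    rw [← this, sub_eq_zero]
    exact Finset.sum_congr rfl fun c _ => mul_comm _ _
  -- The coefficients `s` have no degree bound, so they are reduced modulo `δ`. By `hvδ`, the
  -- quotient parts can be moved onto the pivot vectors `v (I c)`.
  set t : Fin p → ℚ[X] := fun j => s j % δ with ht
  have htdeg : ∀ j, (t j).natDegree ≤ δ.natDegree := by
    intro j
    by_cases h0 : δ.natDegree = 0
    · obtain ⟨c, hc⟩ := natDegree_eq_zero.1 h0
      have : IsUnit δ := by
        rw [← hc]
        refine isUnit_C.2 (IsUnit.mk0 _ ?_)
        rintro rfl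
        exact hdet (by rw [← hc, C_0])
      simp [ht, EuclideanDomain.mod_eq_zero.2 this.dvd]
    · exact (natDegree_mod_lt _ h0).le
  set y : Fin r → ℚ[X] := fun c => ∑ j, s j / δ * M.cramer (fun a => v j (J a)) c with hy
  have hsum : ∑ j, t j • v j + ∑ c, y c • v (I c) = b := by
    have h1 : ∑ c, y c • v (I c) = ∑ j, (s j / δ * δ) • v j := by
      simp only [hy, Finset.sum_smul]
      rw [Finset.sum_comm]
      refine Finset.sum_congr rfl fun j _ => ?_
      rw [mul_smul, hvδ, Finset.smul_sum]
      exact Finset.sum_congr rfl fun c _ => by rw [mul_smul]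
    rw [h1, ← Finset.sum_add_distrib, ← hs]
    refine Finset.sum_congr rfl fun j _ => ?_
    rw [← add_smul, ht, add_comm, mul_comm, EuclideanDomain.div_add_mod]
  set z : Fin r → ℚ[X] := fun a => b (J a) - ∑ j, t j * v j (J a) with hz
  have hzdeg : ∀ a, (z a).natDegree ≤ δ.natDegree + E := by
    intro a
    refine (natDegree_sub_le _ _).trans (max_le ((hb _).trans (Nat.le_add_left _ _)) ?_)
    refine natDegree_sum_le_of_forall_le _ _ fun j _ => natDegree_mul_le.trans ?_
    exact add_le_add (htdeg j) ((hv _ _).trans hDE)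
  have hMy : M.mulVec y = z := by
    funext a
    have := congrFun hsum (J a)
    simp only [Pi.add_apply, Finset.sum_apply, Pi.smul_apply, smul_eq_mul] at this
    simp only [hz, ← this, Matrix.mulVec, dotProduct, hM, Matrix.of_apply, add_sub_cancel_left]
    exact Finset.sum_congr rfl fun c _ => mul_comm _ _
  -- The right side has degree at most `(r - 1) D + deg δ + E`. Since `deg δ` also occurs on the
  -- left, it cancels.
  have hycr : ∀ c, δ * y c = (M.updateCol c z).det := by
    intro c
    rw [← Matrix.cramer_apply, Matrix.cramer_eq_adjugate_mulVec, ← hMy, Matrix.mulVec_mulVec,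
      Matrix.adjugate_mul, Matrix.smul_mulVec, Matrix.one_mulVec]
    rfl
  have hydeg : ∀ c, (y c).natDegree ≤ p * D + (E - D) := by
    intro c
    by_cases hyc : y c = 0
    · simp [hyc]
    have h1 := congrArg natDegree (hycr c)
    rw [natDegree_mul hdet hyc] at h1
    have h2 : (M.updateCol c z).det.natDegree ≤
        ∑ b, Function.update (fun _ => D) c (δ.natDegree + E) b := by
      refine natDegree_det_le fun a b => ?_
      rcases eq_or_ne b c with rfl | hbc
      · simpa using hzdeg a
      · simpa [hbc, hM] using hv _ _
    rw [Finset.sum_update_of_mem (Finset.mem_univ c)] at h2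
    simp only [Finset.sum_const, smul_eq_mul] at h2
    rw [Finset.card_sdiff] at h2
    simp at h2
    have hr : 1 ≤ r := Nat.one_le_iff_ne_zero.2 (by rintro rfl; exact c.elim0)
    have h3 : (r - 1) * D + D ≤ p * D := by
      rw [← Nat.succ_mul]
      exact Nat.mul_le_mul_right _ (by omega)
    omega
  refine ⟨fun j => t j + ∑ c with I c = j, y c, fun j => ?_, ?_⟩
  · refine (natDegree_add_le _ _).trans (max_le ?_ (natDegree_sum_le_of_forall_le _ _
      fun c _ => hydeg c))
    exact (htdeg j).trans (hδdeg.trans ((Nat.mul_le_mul_right _ hrp).trans (Nat.le_add_right _ _)))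
  · simp only [add_smul, Finset.sum_add_distrib]
    rw [← hsum]
    congr 1
    simp only [Finset.sum_smul]
    rw [← Finset.sum_fiberwise (s := Finset.univ) (g := I)]
    refine Finset.sum_congr rfl fun j _ => Finset.sum_congr rfl fun c hc => ?_
    rw [(Finset.mem_filter.1 hc).2]

end DegreeBounds

end PFiniteLearning

namespace PFiniteLearning

/-! ### Length of strict chains of polynomial modules -/

section Hilbert

open Module Submodule

/-- The vectors with entries of degree less than `k` in a module of polynomial vectors. -/
noncomputable def lowDegree {n : ℕ} (N : Submodule ℚ[X] (Fin n → ℚ[X])) (k : ℕ) :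
    Submodule ℚ (Fin n → ℚ[X]) :=
  N.restrictScalars ℚ ⊓ Submodule.pi Set.univ fun _ => degreeLT ℚ k

theorem mem_lowDegree {n : ℕ} {N : Submodule ℚ[X] (Fin n → ℚ[X])} {k : ℕ} {w : Fin n → ℚ[X]} :
    w ∈ lowDegree N k ↔ w ∈ N ∧ ∀ a, w a ∈ degreeLT ℚ k := by
  simp [lowDegree, Submodule.mem_pi]

/-- The entries of a low degree vector at the positions `J`. -/
noncomputable def lowDegreeEntries {n r : ℕ} (N : Submodule ℚ[X] (Fin n → ℚ[X])) (k : ℕ)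
    (J : Fin r → Fin n) : lowDegree N k →ₗ[ℚ] Fin r → degreeLT ℚ k where
  toFun w a := ⟨w.1 (J a), (mem_lowDegree.1 w.2).2 _⟩
  map_add' _ _ := rfl
  map_smul' _ _ := rfl

theorem lowDegreeEntries_injective {n r : ℕ} {N : Submodule ℚ[X] (Fin n → ℚ[X])} {k : ℕ}
    {J : Fin r → Fin n} (hJ : ∀ w ∈ N, (∀ a, w (J a) = 0) → w = 0) :
    Function.Injective (lowDegreeEntries N k J) := by
  rw [← LinearMap.ker_eq_bot, LinearMap.ker_eq_bot']
  intro w hw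
  exact Subtype.ext (hJ w.1 (mem_lowDegree.1 w.2).1 fun a => congrArg Subtype.val (congrFun hw a))

instance {n : ℕ} (N : Submodule ℚ[X] (Fin n → ℚ[X])) (k : ℕ) :
    FiniteDimensional ℚ (lowDegree N k) :=
  Module.Finite.of_injective (lowDegreeEntries N k id)
    (lowDegreeEntries_injective fun _ _ h => funext h)

theorem finrank_degreeLT (k : ℕ) : finrank ℚ (degreeLT ℚ k) = k := by
  rw [(degreeLTEquiv ℚ k).finrank_eq, finrank_fin_fun]

/-- The entries at the pivot positions determine a vector of the module. -/
theorem finrank_lowDegree_le {n r : ℕ} {N : Submodule ℚ[X] (Fin n → ℚ[X])} (k : ℕ)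
    {J : Fin r → Fin n} (hJ : ∀ w ∈ N, (∀ a, w (J a) = 0) → w = 0) :
    finrank ℚ (lowDegree N k) ≤ r * k := by
  refine (LinearMap.finrank_le_finrank_of_injective (lowDegreeEntries_injective hJ)).trans ?_
  simp [finrank_pi_fintype, finrank_degreeLT]

/-- Multiplying each of the `r` independent vectors by arbitrary polynomials of degree less than `m`
embeds a space of dimension `r * m`. -/
theorem le_finrank_lowDegree {n r : ℕ} {N : Submodule ℚ[X] (Fin n → ℚ[X])} {D : ℕ}
    (w : Fin r → Fin n → ℚ[X]) (hwN : ∀ b, w b ∈ N) (hwD : ∀ b a, (w b a).natDegree ≤ D)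
    (hw : ∀ y : Fin r → ℚ[X], ∑ b, y b • w b = 0 → y = 0) (m : ℕ) :
    r * m ≤ finrank ℚ (lowDegree N (m + D)) := by
  let φ : (Fin r → degreeLT ℚ m) →ₗ[ℚ] lowDegree N (m + D) :=
    { toFun := fun y => ⟨∑ b, (y b : ℚ[X]) • w b, mem_lowDegree.2
        ⟨sum_mem fun b _ => N.smul_mem _ (hwN b), fun a => by
          rw [Finset.sum_apply]
          refine sum_mem fun b _ => mem_degreeLT.2 ?_
          rw [Pi.smul_apply, smul_eq_mul]
          by_cases h0 : (y b : ℚ[X]) * w b a = 0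
          · rw [h0, degree_zero]
            exact WithBot.bot_lt_coe _
          · have hy := mem_degreeLT.1 (y b).2
            have h1 := left_ne_zero_of_mul h0
            rw [degree_eq_natDegree h0]
            rw [degree_eq_natDegree h1] at hy
            rw [natDegree_mul h1 (right_ne_zero_of_mul h0)]
            exact_mod_cast add_lt_add_of_lt_of_le (by exact_mod_cast hy) (hwD b a)⟩⟩
      map_add' := fun y z => Subtype.ext (by simp [add_smul, Finset.sum_add_distrib])
      map_smul' := fun c y => Subtype.ext (by simp [Finset.smul_sum]) }
  have hφ : Function.Injective φ := by
    rw [← LinearMap.ker_eq_bot, LinearMap.ker_eq_bot']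
    intro y hy
    have := hw (fun b => (y b : ℚ[X])) (congrArg Subtype.val hy)
    funext b
    exact Subtype.ext (congrFun this b)
  have := LinearMap.finrank_le_finrank_of_injective hφ
  simpa [finrank_pi_fintype, finrank_degreeLT] using this

/-- The module generated by the first `i` members of a sequence of polynomial vectors. -/
noncomputable def initialSpan {n : ℕ} (v : ℕ → Fin n → ℚ[X]) (i : ℕ) :
    Submodule ℚ[X] (Fin n → ℚ[X]) :=
  span ℚ[X] (Set.range fun j : Fin i => v j)

/-- The rank of the first `i` members of a sequence of polynomial vectors. -/
noncomputable def initialRank {n : ℕ} (v : ℕ → Fin n → ℚ[X]) (i : ℕ) : ℕ :=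
  fracRank fun j : Fin i => v j

theorem initialSpan_mono {n : ℕ} (v : ℕ → Fin n → ℚ[X]) : Monotone (initialSpan v) := by
  intro i j hij
  refine span_mono ?_
  rintro _ ⟨l, rfl⟩
  exact ⟨⟨l, l.2.trans_le hij⟩, rfl⟩

theorem initialRank_mono {n : ℕ} (v : ℕ → Fin n → ℚ[X]) : Monotone (initialRank v) := by
  intro i j hij
  refine finrank_mono (span_mono ?_)
  rintro _ ⟨l, rfl⟩
  exact ⟨⟨l, l.2.trans_le hij⟩, rfl⟩

theorem initialRank_le {n : ℕ} (v : ℕ → Fin n → ℚ[X]) (i : ℕ) : initialRank v i ≤ n := by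
  simpa [initialRank, fracRank] using (finrank_le (span (FractionRing ℚ[X])
    (Set.range fun (j : Fin i) a => algebraMap ℚ[X] (FractionRing ℚ[X]) (v j a))))

variable {n p d : ℕ} {v : ℕ → Fin n → ℚ[X]}

theorem add_le_finrank_lowDegree {q t k : ℕ} (hchain : ∀ i < q + t, v i ∉ initialSpan v i)
    (hk : ∀ i < q + t, ∀ a, v i a ∈ degreeLT ℚ k) :
    finrank ℚ (lowDegree (initialSpan v q) k) + t ≤
      finrank ℚ (lowDegree (initialSpan v (q + t)) k) := by
  induction t with
  | zero => simp
  | succ t ih =>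
    have h1 := ih (fun i hi => hchain i (by omega)) fun i hi => hk i (by omega)
    have h2 : lowDegree (initialSpan v (q + t)) k < lowDegree (initialSpan v (q + t + 1)) k := by
      refine SetLike.lt_iff_le_and_exists.2 ⟨fun w hw => ?_, v (q + t), ?_, fun h => ?_⟩
      · rw [mem_lowDegree] at hw ⊢
        exact ⟨initialSpan_mono v (Nat.le_succ _) hw.1, hw.2⟩
      · exact mem_lowDegree.2 ⟨subset_span ⟨Fin.last _, rfl⟩, hk _ (by omega)⟩
      · exact hchain _ (by omega) (mem_lowDegree.1 h).1
    have h3 := finrank_lt_finrank_of_lt h2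
    change _ ≤ finrank ℚ (lowDegree (initialSpan v (q + t + 1)) k)
    omega

/-- In a strictly increasing chain, steps that do not change the rank are bounded in number. -/
theorem steps_le_of_initialRank_eq {q t : ℕ} (hchain : ∀ i < q + t, v i ∉ initialSpan v i)
    (hdeg : ∀ i < q + t, ∀ a, (v i a).natDegree ≤ d * (i + 1))
    (hrank : initialRank v (q + t) = initialRank v q) :
    t ≤ initialRank v q * (d * q) := by
  obtain ⟨-, J, -, hJ⟩ := exists_minor_det_ne_zero fun j : Fin (q + t) => v j
  obtain ⟨I, J', hdet⟩ : ∃ (I : Fin (initialRank v q) → Fin q) (J' : Fin (initialRank v q) → Fin n),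
      (Matrix.of fun a b => v (I b) (J' a)).det ≠ 0 := by
    obtain ⟨I, J', hdet, -⟩ := exists_minor_det_ne_zero fun j : Fin q => v j
    exact ⟨I, J', hdet⟩
  change Fin (initialRank v (q + t)) → _ at J
  have hup := fun k => finrank_lowDegree_le (N := initialSpan v (q + t)) k (J := J) hJ
  rw [hrank] at hup
  have hlow := le_finrank_lowDegree (N := initialSpan v q) (D := d * q) (fun b => v (I b))
    (fun b => subset_span ⟨I b, rfl⟩)
    (fun b a => (hdeg _ (by omega) a).trans (Nat.mul_le_mul_left _ (I b).2))
    (fun y hy => by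
      refine Matrix.eq_zero_of_mulVec_eq_zero hdet ?_
      funext a
      have := congrFun hy (J' a)
      simp only [Finset.sum_apply, Pi.smul_apply, smul_eq_mul] at this
      exact (Finset.sum_congr rfl fun b _ => mul_comm _ _).trans this) (d * t + 1)
  -- This cutoff exceeds the degree bound `d (q + t)` of all the generators, so each strict step is
  -- visible in low degree and adds at least one dimension.
  have hmid := add_le_finrank_lowDegree (k := d * t + 1 + d * q) hchain fun i hi a => by
    rw [mem_degreeLT]
    refine degree_le_natDegree.trans_lt (Nat.cast_lt.2 ((hdeg i hi a).trans_lt ?_))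
    have : d * (i + 1) ≤ d * q + d * t := mul_add d q t ▸ Nat.mul_le_mul_left _ hi
    omega
  -- With `ρ` the common rank, the three bounds give `ρ (d t + 1) + t ≤ ρ (d t + 1) + ρ (d q)`.
  have := hup (d * t + 1 + d * q)
  rw [mul_add] at this
  omega

/-- A stretch of constant rank starting at `q` multiplies the index by at most `1 + rank * d`, and
there is at most one stretch for each rank. The case `i = 0` is kept apart because the power bound
is 1 at `r = 0`, where a strict chain must be empty. -/
theorem chain_length_le_of_initialRank_le (hn : 0 < n)
    (hchain : ∀ i < p, v i ∉ initialSpan v i)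
    (hdeg : ∀ i < p, ∀ a, (v i a).natDegree ≤ d * (i + 1)) (r : ℕ) :
    ∀ i ≤ p, initialRank v i ≤ r → i = 0 ∨ 0 < r ∧ i ≤ ((d + 1) * n ^ 2) ^ r := by
  induction r with
  | zero =>
    intro i hi hr
    left
    by_contra h0
    obtain ⟨-, J, -, hJ⟩ := exists_minor_det_ne_zero fun j : Fin i => v j
    change Fin (initialRank v i) → _ at J
    refine hchain 0 (by omega) ?_
    have : v 0 = 0 := hJ (v 0) (subset_span ⟨⟨0, by omega⟩, rfl⟩) fun a =>
      absurd (lt_of_lt_of_le a.2 hr) (Nat.not_lt_zero _)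
    rw [this]
    exact zero_mem _
  | succ r ih =>
    intro i hi hr
    refine or_iff_not_imp_left.2 fun h0 => ⟨r.succ_pos, ?_⟩
    have hpos : 0 < (d + 1) * n ^ 2 := by positivity
    rcases Nat.lt_or_ge r (initialRank v i) with hlt | hle
    swap
    · rcases ih i hi hle with h | h
      · exact absurd h h0
      · exact h.2.trans (Nat.pow_le_pow_right hpos r.le_succ)
    have hri : initialRank v i = r + 1 := by omega
    have hrn : r + 1 ≤ n := hri ▸ initialRank_le v i
    classical
    have hex : ∃ q, r < initialRank v q := ⟨i, hlt⟩
    -- The rank is constant from `q` to `i`, while `q - 1` falls under the induction hypothesis.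
    set q := Nat.find hex with hq
    have hqr : r < initialRank v q := Nat.find_spec hex
    have hqi : q ≤ i := Nat.find_min' hex hlt
    have hqrank : initialRank v q = r + 1 := le_antisymm (hri ▸ initialRank_mono v hqi) hqr
    obtain ⟨t, rfl⟩ := Nat.exists_eq_add_of_le hqi
    have ht := steps_le_of_initialRank_eq (fun j hj => hchain j (by omega))
      (fun j hj => hdeg j (by omega)) (hri.trans hqrank.symm)
    rw [hqrank] at ht
    have hqpos : q ≠ 0 := by
      intro hq0
      rw [hq0] at hqr
      have : initialRank v 0 = 0 := by simp [initialRank, fracRank]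
      omega
    have hqpred : initialRank v (q - 1) ≤ r := by
      have := Nat.find_min hex (m := q - 1) (by omega)
      omega
    have hbound : q + t ≤ q * (1 + (r + 1) * d) := by
      calc q + t ≤ q + (r + 1) * (d * q) := by omega
        _ = q * (1 + (r + 1) * d) := by ring
    refine hbound.trans ?_
    have hfac : 1 + (r + 1) * d ≤ (d + 1) * n := by nlinarith
    rcases ih (q - 1) (by omega) hqpred with h | ⟨hr0, h⟩
    · have hq1 : q = 1 := by omega
      rw [hq1, one_mul]
      calc 1 + (r + 1) * d ≤ (d + 1) * n ^ 2 := hfac.trans (by gcongr; nlinarith)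
        _ ≤ _ := Nat.le_self_pow (by omega) _
    -- Here `r > 0`, so `n ≥ r + 1 ≥ 2` and `q ≤ B + 1 ≤ 2 B ≤ n B`. This is where the second factor
    -- `n` is spent.
    · set B := ((d + 1) * n ^ 2) ^ r
      have hB : 0 < B := Nat.pow_pos hpos
      calc q * (1 + (r + 1) * d) ≤ (2 * B) * ((d + 1) * n) := Nat.mul_le_mul (by omega) hfac
        _ ≤ (n * B) * ((d + 1) * n) := by gcongr; omega
        _ = _ := by rw [pow_succ]; ring

/-- The length of a strictly increasing chain of modules of polynomial vectors whose generators
have linearly bounded degrees. -/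
theorem chain_length_le (hchain : ∀ i < p, v i ∉ initialSpan v i)
    (hdeg : ∀ i < p, ∀ a, (v i a).natDegree ≤ d * (i + 1)) : p ≤ columnBound d n := by
  rcases Nat.eq_zero_or_pos n with rfl | hn
  · by_contra hp
    refine hchain 0 (by simp [columnBound] at hp; omega) ?_
    rw [Subsingleton.elim (v 0) 0]
    exact zero_mem _
  · rcases chain_length_le_of_initialRank_le hn hchain hdeg n p le_rfl (initialRank_le v p) with
      h | h
    · simp [h]
    · exact h.2

theorem columnBound_mono {n n' : ℕ} (h : n ≤ n') : columnBound d n ≤ columnBound d n' := by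
  rcases Nat.eq_zero_or_pos n' with h' | h'
  · obtain rfl : n = n' := by omega
    exact le_rfl
  · exact (Nat.pow_le_pow_left (by gcongr) n).trans (Nat.pow_le_pow_right (by positivity) h)

theorem one_le_columnBound (d n : ℕ) : 1 ≤ columnBound d n :=
  (by simp [columnBound] : 1 ≤ columnBound d 0).trans (columnBound_mono n.zero_le)

end Hilbert

end PFiniteLearning

/-! ### Backward polynomial vectors of a P-finite automaton -/

namespace PFiniteAutomaton

variable {α : Type*} {n : ℕ}

theorem transWordAt_append (A : PFiniteAutomaton α n) (u w : List α) (k : ℕ) :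
    A.transWordAt (u ++ w) k = A.transWordAt u k * A.transWordAt w (k + u.length) := by
  induction u generalizing k with
  | nil => simp [transWordAt]
  | cons a u ih =>
    rw [List.cons_append, transWordAt, transWordAt, ih, Matrix.mul_assoc, List.length_cons,
      Nat.add_right_comm, Nat.add_assoc]

/-- The polynomial vector whose value at `k` is the column vector that is obtained by reading a
word backwards from the final vector, the first letter at position `k`. -/
noncomputable def backVec (A : PFiniteAutomaton α n) : List α → Fin n → ℚ[X]
  | [] => A.final
  | a :: w => (A.trans a).mulVec fun i => (backVec A w i).comp (X + 1)

theorem eval_backVec (A : PFiniteAutomaton α n) (w : List α) (k : ℕ) :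
    (fun i => (A.backVec w i).eval (k : ℚ)) =
      (A.transWordAt w k).mulVec fun i => (A.final i).eval ((k + w.length : ℕ) : ℚ) := by
  induction w generalizing k with
  | nil => simp [backVec, transWordAt]
  | cons a w ih =>
    have h := ih (k + 1)
    rw [transWordAt, ← Matrix.mulVec_mulVec, List.length_cons, ← Nat.add_assoc,
      Nat.add_right_comm, ← h]
    funext i
    simp [backVec, Matrix.mulVec, dotProduct, eval_finsetSum, transAt]

theorem sem_append (A : PFiniteAutomaton α n) (u w : List α) :
    A.sem (u ++ w) = dotProduct (Matrix.vecMul A.init (A.transWordAt u 1))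
      fun i => (A.backVec w i).eval ((u.length + 1 : ℕ) : ℚ) := by
  rw [eval_backVec, Matrix.dotProduct_mulVec, Matrix.vecMul_vecMul, Nat.add_comm u.length 1,
    ← transWordAt_append, sem, List.length_append, Nat.add_comm 1, Nat.add_right_comm]

/-- The shift `X ↦ X + 1` preserves degrees, so each letter contributes at most `d`, as does the
final vector. -/
theorem natDegree_backVec_le [Fintype α] (A : PFiniteAutomaton α n) {d : ℕ}
    (hd : A.maxDegree ≤ d) (w : List α) (i : Fin n) :
    (A.backVec w i).natDegree ≤ d * (w.length + 1) := by
  have h1 := (le_max_left _ _).trans hd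
  have h2 := (le_max_right _ _).trans hd
  induction w generalizing i with
  | nil => simpa [backVec] using (Finset.sup_le_iff.1 h2) i (Finset.mem_univ i)
  | cons a w ih =>
    change (∑ j, A.trans a i j * (A.backVec w j).comp (X + 1)).natDegree ≤ _
    refine natDegree_sum_le_of_forall_le _ _ fun j _ => natDegree_mul_le.trans ?_
    have h3 : (A.trans a i j).natDegree ≤ d :=
      Finset.sup_le_iff.1 (Finset.sup_le_iff.1 (Finset.sup_le_iff.1 h1 a (Finset.mem_univ a)) i
        (Finset.mem_univ i)) j (Finset.mem_univ j)
    have h4 : ((A.backVec w j).comp (X + 1)).natDegree ≤ d * (w.length + 1) := by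
      rw [natDegree_comp, ← C_1, natDegree_X_add_C, mul_one]
      exact ih j
    rw [List.length_cons, Nat.mul_succ, Nat.add_comm]
    exact add_le_add h4 h3

end PFiniteAutomaton

namespace PFiniteLearning

variable {α : Type*}

open Submodule

/-! ### Linear algebra of the extended table -/

section Rows

/-- The row of the extended table that belongs to the word `r`. -/
def extendedRow (f : List α → ℚ) (e : ℕ) (C : List (List α)) (r : List α) :
    Fin (e + 1) × Fin C.length → ℚ :=
  fun kj => ((r.length + 1 : ℕ) : ℚ) ^ (kj.1 : ℕ) * f (r ++ C.get kj.2)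

/-- The rows of the extended table are linearly independent. -/
def IndependentRows (f : List α → ℚ) (e : ℕ) (R C : List (List α)) : Prop :=
  LinearIndependent ℚ fun i : Fin R.length => extendedRow f e C (R.get i)

theorem linearIndependent_get_append_singleton {V : Type*} [AddCommGroup V] [Module ℚ V]
    {β : Type*} (g : β → V) (R : List β) (u : β) :
    (LinearIndependent ℚ fun i : Fin (R ++ [u]).length => g ((R ++ [u]).get i)) ↔
      (LinearIndependent ℚ fun i : Fin R.length => g (R.get i)) ∧
        g u ∉ span ℚ (Set.range fun i : Fin R.length => g (R.get i)) := by
  have hlen : R.length + 1 = (R ++ [u]).length := by simp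
  rw [← linearIndependent_finSnoc, ← linearIndependent_equiv (finCongr hlen)]
  congr! 1
  funext i
  refine Fin.lastCases ?_ (fun i => ?_) i
  · simp
  · simp

theorem rank_extendedTable_eq_iff (f : List α → ℚ) (e : ℕ) (R C : List (List α)) :
    (extendedTable f e R C).rank = R.length ↔ IndependentRows f e R C := by
  rw [Matrix.rank_eq_finrank_span_row, IndependentRows,
    linearIndependent_iff_card_eq_finrank_span, Fintype.card_fin, eq_comm]
  rfl

theorem IndependentRows.length_le {f : List α → ℚ} {e : ℕ} {R C : List (List α)}
    (h : IndependentRows f e R C) : R.length ≤ (e + 1) * C.length := by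
  simpa using h.fintype_card_le_finrank

/-- Independent rows give a right inverse, which solves the systems of all letters at once. -/
theorem IndependentRows.exists_isHypothesis {f : List α → ℚ} {e : ℕ} {R C : List (List α)}
    (h : IndependentRows f e R C) : ∃ A, IsHypothesis f e R C A := by
  obtain ⟨B, hB⟩ : ∃ B : Matrix (Fin (e + 1) × Fin C.length) (Fin R.length) ℚ,
      extendedTable f e R C * B = 1 := by
    rw [← Matrix.mulVec_surjective_iff_exists_right_inverse, ← Matrix.coe_mulVecLin,
      ← LinearMap.range_eq_top]
    refine Submodule.eq_top_of_finrank_eq ?_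
    rw [Module.finrank_fin_fun]
    exact (rank_extendedTable_eq_iff f e R C).2 h
  exact ⟨_, fun a => B * shiftedTable f R C a,
    fun a => by rw [← Matrix.mul_assoc, hB, Matrix.one_mul], rfl⟩

/-- A vector on which a functional does not vanish is not in the span of vectors on which it
does. -/
theorem notMem_span_of_apply_ne_zero {ι V : Type*} [AddCommGroup V] [Module ℚ V] {g : ι → V}
    {x : V} (φ : V →ₗ[ℚ] ℚ) (hg : ∀ i, φ (g i) = 0) (hx : φ x ≠ 0) :
    x ∉ span ℚ (Set.range g) := fun h =>
  hx ((span_le (p := LinearMap.ker φ)).2 (by rintro _ ⟨i, rfl⟩; exact hg i) h)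

/-- The dot product with a fixed vector, as a linear functional. -/
def dotRight {κ : Type*} [Fintype κ] (z : κ → ℚ) : (κ → ℚ) →ₗ[ℚ] ℚ where
  toFun x := dotProduct x z
  map_add' x y := add_dotProduct x y z
  map_smul' c x := smul_dotProduct c x z

/-- The vector `y` lists the coefficients of the multipliers `q j`; pairing them with the powers of
`|r| + 1` in the extended row evaluates `q j` at that position. Hence `y` serves all `r`
simultaneously. -/
theorem exists_column_of_mem_span {n : ℕ} [Fintype α] (A : PFiniteAutomaton α n) {d : ℕ}
    (hd : A.maxDegree ≤ d) {C : List (List α)} (hC : ∀ i : Fin C.length, (C.get i).length ≤ i)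
    {a : α} {c : List α} (hc : c ∈ C)
    (hmem : A.backVec (a :: c) ∈
      span ℚ[X] (Set.range fun j : Fin C.length => A.backVec (C.get j))) :
    ∃ y : Fin (d * (C.length + 1) * C.length + 1) × Fin C.length → ℚ, ∀ r : List α,
      dotProduct (extendedRow A.sem (d * (C.length + 1) * C.length) C r) y =
        A.sem (r ++ a :: c) := by
  obtain ⟨i, hi⟩ := List.get_of_mem hc
  obtain ⟨q, hq, hsum⟩ := exists_combination_natDegree_le (fun j => A.backVec (C.get j))
    (A.backVec (a :: c)) (D := d * C.length) (E := d * (C.length + 1))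
    (Nat.mul_le_mul_left _ (Nat.le_succ _))
    (fun j b => (A.natDegree_backVec_le hd _ b).trans
      (Nat.mul_le_mul_left _ (Nat.succ_le_of_lt ((hC j).trans_lt j.2))))
    (fun b => (A.natDegree_backVec_le hd _ b).trans (Nat.mul_le_mul_left _ (by
      have := hC i
      rw [hi] at this
      simp only [List.length_cons]
      omega))) hmem
  have hp : 1 ≤ C.length := List.length_pos_of_mem hc
  -- With `p = |C| ≥ 1`, the bound is `p (d p) + d ≤ d (p + 1) p`.
  have hdeg : ∀ j, (q j).natDegree < d * (C.length + 1) * C.length + 1 := fun j =>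
    Nat.lt_succ_of_le ((hq j).trans (by
      rw [Nat.mul_succ, Nat.add_sub_cancel_left, add_mul, ← mul_comm (d * C.length)]
      exact Nat.add_le_add_left (Nat.le_mul_of_pos_right _ hp) _))
  refine ⟨fun kj => (q kj.2).coeff kj.1, fun r => ?_⟩
  rw [A.sem_append, ← hsum]
  simp only [dotProduct, extendedRow, Fintype.sum_prod_type_right]
  calc _ = ∑ j, (q j).eval ((r.length + 1 : ℕ) : ℚ) * A.sem (r ++ C.get j) := by
        refine Finset.sum_congr rfl fun j _ => ?_
        rw [eval_eq_sum_range' (hdeg j), Finset.sum_mul, ← Fin.sum_univ_eq_sum_range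
          (fun k => (q j).coeff k * ((r.length + 1 : ℕ) : ℚ) ^ k * A.sem (r ++ C.get j))]
        exact Finset.sum_congr rfl fun k _ => by ring
    _ = _ := by
        simp only [A.sem_append, dotProduct, Finset.sum_apply, Pi.smul_apply, smul_eq_mul,
          eval_finsetSum, eval_mul, Finset.mul_sum]
        rw [Finset.sum_comm]
        exact Finset.sum_congr rfl fun b _ => Finset.sum_congr rfl fun j _ => by ring

end Rows

/-! ### Extracting information from counterexamples -/

section Prefix

variable {f : List α → ℚ} {C : List (List α)}

/-- Loop invariant: the current vector of the hypothesis is the table row of the prefix read so far.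
This lets the failing step be stated with the table row of `u'` in place of the hypothesis vector.
-/
theorem largestCorrectPrefixLoop_spec (A : PFiniteAutomaton α C.length) (w : List α) :
    ∀ u : List α,
      Matrix.vecMul A.init (A.transWordAt u 1) = (fun j => f (u ++ C.get j)) →
      match largestCorrectPrefixLoop f C A (Matrix.vecMul A.init (A.transWordAt u 1)) u w with
      | none => Matrix.vecMul A.init (A.transWordAt (u ++ w) 1) = fun j => f (u ++ w ++ C.get j)
      | some (u', a, c) => ∃ j, c = C.get j ∧
          Matrix.vecMul A.init (A.transWordAt u' 1) = (fun j => f (u' ++ C.get j)) ∧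
          Matrix.vecMul (fun j => f (u' ++ C.get j)) (A.transAt a (u'.length + 1)) j ≠
            f (u' ++ a :: c) := by
  induction w with
  | nil =>
    intro u hu
    simpa [largestCorrectPrefixLoop] using hu
  | cons a w ih =>
    intro u hu
    have hstep : Matrix.vecMul (Matrix.vecMul A.init (A.transWordAt u 1))
        (A.transAt a (u.length + 1)) = Matrix.vecMul A.init (A.transWordAt (u ++ [a]) 1) := by
      rw [Matrix.vecMul_vecMul, A.transWordAt_append]
      simp [PFiniteAutomaton.transWordAt, Nat.add_comm]
    rw [largestCorrectPrefixLoop]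
    split
    · rename_i heq
      split at heq
      · exact absurd heq (by simp)
      · rename_i hfind
        rw [List.find?_eq_none] at hfind
        have hnext : Matrix.vecMul A.init (A.transWordAt (u ++ [a]) 1) =
            fun j => f (u ++ [a] ++ C.get j) := by
          rw [← hstep]
          funext j
          simpa using hfind j (List.mem_finRange j)
        have := ih (u ++ [a]) hnext
        rw [hstep] at heq
        rw [heq] at this
        simpa using this
    · rename_i u' a' c heq
      split at heq
      · rename_i j hfind
        have hj := List.find?_some hfind
        simp only [Option.some.injEq, Prod.mk.injEq] at heq
        obtain ⟨rfl, rfl, rfl⟩ := heq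
        refine ⟨j, rfl, hu, ?_⟩
        rw [← hu]
        simpa using hj
      · rename_i hfind
        rw [List.find?_eq_none] at hfind
        have hnext : Matrix.vecMul A.init (A.transWordAt (u ++ [a]) 1) =
            fun j => f (u ++ [a] ++ C.get j) := by
          rw [← hstep]
          funext j
          simpa using hfind j (List.mem_finRange j)
        have := ih (u ++ [a]) hnext
        rw [hstep] at heq
        rw [heq] at this
        exact this

theorem init_eq_of_isHypothesis {e : ℕ} {R : List (List α)} {A : PFiniteAutomaton α C.length}
    (hR : R.head? = some []) (hA : IsHypothesis f e R C A) : A.init = fun j => f (C.get j) := by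
  obtain ⟨Y, -, rfl⟩ := hA
  obtain ⟨R, rfl⟩ : ∃ R', R = [] :: R' := List.head?_eq_some_iff.1 hR
  funext j
  simp only [assemble, Matrix.vecMul, dotProduct, List.length_cons, Fin.sum_univ_succ]
  simp [e₁, table]

/-- The final vector selects the column of `ε`. Hence a genuine counterexample must have an
incorrect prefix. -/
theorem sem_eq_of_isHypothesis {e : ℕ} {R : List (List α)} {A : PFiniteAutomaton α C.length}
    (hC : C.head? = some []) (hA : IsHypothesis f e R C A) {w : List α}
    (hw : Matrix.vecMul A.init (A.transWordAt w 1) = fun j => f (w ++ C.get j)) :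
    A.sem w = f w := by
  rw [PFiniteAutomaton.sem, hw]
  obtain ⟨Y, -, rfl⟩ := hA
  obtain ⟨C, rfl⟩ : ∃ C', C = [] :: C' := List.head?_eq_some_iff.1 hC
  simp only [assemble, dotProduct, List.length_cons, Fin.sum_univ_succ]
  simp [e₁]

/-- Turns a wrong transition of the hypothesis into a statement about one column of `Y a` and the
extended row of `u`. -/
theorem vecMul_transAt_of_isHypothesis {e : ℕ} {R : List (List α)}
    {Y : α → Matrix (Fin (e + 1) × Fin C.length) (Fin C.length) ℚ} (u : List α) (a : α)
    (j : Fin C.length) :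
    Matrix.vecMul (fun j => f (u ++ C.get j)) ((assemble f e R C Y).transAt a (u.length + 1)) j =
      dotProduct (extendedRow f e C u) fun ki => Y a ki j := by
  simp only [Matrix.vecMul, dotProduct, extendedRow, Fintype.sum_prod_type_right, assemble,
    PFiniteAutomaton.transAt, Matrix.map_apply, Matrix.of_apply, eval_finsetSum, Finset.mul_sum]
  refine Finset.sum_congr rfl fun i _ => Finset.sum_congr rfl fun k _ => ?_
  simp only [eval_mul, eval_C, eval_pow, eval_X]
  ring

end Prefix

end PFiniteLearning

/-! ### The invariant of the learner and termination -/

namespace PFiniteLearning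

variable {α : Type*} {n : ℕ}

open Submodule

/-- The polynomial vector of the `i`-th column. -/
noncomputable def columnVec (A : PFiniteAutomaton α n) (C : List (List α)) (i : ℕ) :
    Fin n → ℚ[X] :=
  A.backVec (C.getD i [])

/-- What holds in every call of the partial learner with target `A`, unless `A` computes the zero
function: the rows of the extended table are linearly independent, or the row of `ε` is zero, and
the polynomial vectors of the columns generate a strictly increasing chain of modules. -/
structure Invariant (A : PFiniteAutomaton α n) (d : ℕ) (T : Args α) : Prop where
  head_rows : T.R.head? = some []
  head_cols : T.C.head? = some []
  length_le : ∀ i : Fin T.C.length, (T.C.get i).length ≤ i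
  chain : ∀ i < T.C.length, columnVec A T.C i ∉ initialSpan (columnVec A T.C) i
  rows : IndependentRows A.sem (T.degree d) T.R T.C ∨ ∀ c ∈ T.C, A.sem c = 0

theorem initialSpan_columnVec_append (A : PFiniteAutomaton α n) (C : List (List α)) (c : List α)
    {i : ℕ} (hi : i ≤ C.length) :
    initialSpan (columnVec A (C ++ [c])) i = initialSpan (columnVec A C) i := by
  unfold initialSpan
  congr 2
  funext j
  rw [columnVec, columnVec, List.getD_append _ _ _ _ (j.2.trans_le hi)]

theorem initialSpan_columnVec_length (A : PFiniteAutomaton α n) (C : List (List α)) :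
    initialSpan (columnVec A C) C.length =
      span ℚ[X] (Set.range fun j : Fin C.length => A.backVec (C.get j)) := by
  unfold initialSpan
  congr 2
  funext j
  rw [columnVec, List.getD_eq_getElem _ _ j.2, List.get_eq_getElem]

theorem Invariant.length_cols_le [Fintype α] {A : PFiniteAutomaton α n} {d : ℕ} {T : Args α}
    (hT : Invariant A d T) (hd : A.maxDegree ≤ d) : T.C.length ≤ columnBound d n := by
  refine chain_length_le hT.chain fun i hi a => (A.natDegree_backVec_le hd _ a).trans
    (Nat.mul_le_mul_left _ ?_)
  rw [List.getD_eq_getElem _ _ hi]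
  exact Nat.succ_le_succ (hT.length_le ⟨i, hi⟩)

/-- The first chain step requires `A.final ≠ 0`, because the vector of the column `ε` is the final
vector. -/
theorem Invariant.start {A : PFiniteAutomaton α n} (d : ℕ) (h0 : A.final ≠ 0) :
    Invariant A d (Args.start α) where
  head_rows := rfl
  head_cols := rfl
  length_le
    | ⟨0, _⟩ => le_rfl
    | ⟨i + 1, h⟩ => absurd h (by simp [Args.start])
  chain i hi := by
    obtain rfl : i = 0 := by simpa [Args.start] using hi
    simpa [initialSpan, columnVec, Args.start, PFiniteAutomaton.backVec] using h0
  rows := by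
    by_cases h : A.sem [] = 0
    · right
      simpa [Args.start] using h
    · left
      refine (linearIndependent_unique_iff (ι := Fin 1)).2 fun h' => h ?_
      simpa [extendedRow, Args.start] using congrFun h' (0, (0 : Fin 1))

theorem extendedRow_eq_zero {f : List α → ℚ} {e : ℕ} {C : List (List α)} {r : List α}
    (h : ∀ j, f (r ++ C.get j) = 0) : extendedRow f e C r = 0 := by
  funext kj
  rw [extendedRow, h, mul_zero, Pi.zero_apply]

theorem extendedTable_mul_apply (f : List α → ℚ) (e : ℕ) (R C : List (List α))
    {κ : Type*} (Y : Matrix (Fin (e + 1) × Fin C.length) κ ℚ) (i : Fin R.length) (j : κ) :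
    (extendedTable f e R C * Y) i j =
      dotProduct (extendedRow f e C (R.get i)) fun ki => Y ki j := rfl

theorem degree_le_of_append (d : ℕ) (R R' C : List (List α)) (c : List α) :
    Args.degree d ⟨R, C⟩ ≤ Args.degree d ⟨R', C ++ [c]⟩ := by
  simp only [Args.degree, List.length_append, List.length_singleton]
  gcongr <;> omega

/-- The functional "pair the old entries with `y`, then subtract the new column's entry" vanishes on
the rows of `R` but not on that of `u`. -/
theorem IndependentRows.append_column {f : List α → ℚ} {e e' : ℕ} {R C : List (List α)}
    (h : IndependentRows f e R C) (hee : e ≤ e') {u c : List α}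
    {y : Fin (e + 1) × Fin C.length → ℚ}
    (hR : ∀ i, dotProduct (extendedRow f e C (R.get i)) y = f (R.get i ++ c))
    (hu : dotProduct (extendedRow f e C u) y ≠ f (u ++ c)) :
    IndependentRows f e' (R ++ [u]) (C ++ [c]) := by
  have hlen : C.length < (C ++ [c]).length := by simp
  let emb : Fin (e + 1) × Fin C.length → Fin (e' + 1) × Fin (C ++ [c]).length :=
    Prod.map (Fin.castLE (Nat.succ_le_succ hee)) (Fin.castLE hlen.le)
  have hemb : ∀ r, LinearMap.funLeft ℚ ℚ emb (extendedRow f e' (C ++ [c]) r) =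
      extendedRow f e C r := by
    intro r
    funext kj
    simp [LinearMap.funLeft_apply, emb, extendedRow]
  let φ : (Fin (e' + 1) × Fin (C ++ [c]).length → ℚ) →ₗ[ℚ] ℚ :=
    dotRight y ∘ₗ LinearMap.funLeft ℚ ℚ emb - LinearMap.proj (0, ⟨C.length, hlen⟩)
  have hφ : ∀ r, φ (extendedRow f e' (C ++ [c]) r) =
      dotProduct (extendedRow f e C r) y - f (r ++ c) := by
    intro r
    rw [← hemb r]
    simp [φ, dotRight, extendedRow]
  refine (linearIndependent_get_append_singleton _ R u).2 ⟨?_, notMem_span_of_apply_ne_zero φ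
    (fun i => ?_) ?_⟩
  · refine LinearIndependent.of_comp (LinearMap.funLeft ℚ ℚ emb) ?_
    exact (funext fun i => hemb (R.get i) : LinearMap.funLeft ℚ ℚ emb ∘
      (fun i : Fin R.length => extendedRow f e' (C ++ [c]) (R.get i)) =
        fun i => extendedRow f e C (R.get i)) ▸ h
  · rw [hφ, hR, sub_self]
  · rw [hφ]
    exact sub_ne_zero.2 hu

theorem Invariant.recursiveCallOn [Fintype α] {A : PFiniteAutomaton α n} {d ℓ : ℕ}
    {T T' : Args α} (hd : A.maxDegree ≤ d) (hT : Invariant A d T)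
    {B : PFiniteAutomaton α T.C.length} {w : List α}
    (h : RecursiveCallOn A.sem d ℓ T B w T') : Invariant A d T' := by
  obtain ⟨-, hB, -, u, a, c, hloop, rfl⟩ := h
  have hinit := init_eq_of_isHypothesis hT.head_rows hB
  have hspec := largestCorrectPrefixLoop_spec (f := A.sem) B w []
    (by simpa [PFiniteAutomaton.transWordAt] using hinit)
  rw [PFiniteAutomaton.transWordAt, Matrix.vecMul_one, ← largestCorrectPrefix, hloop] at hspec
  obtain ⟨j, rfl, hu, hne⟩ := hspec
  obtain ⟨Y, hY, rfl⟩ := hB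
  rw [vecMul_transAt_of_isHypothesis (R := T.R)] at hne
  have hR : ∀ i, dotProduct (extendedRow A.sem (T.degree d) T.C (T.R.get i)) (fun ki => Y a ki j) =
      A.sem (T.R.get i ++ a :: T.C.get j) := fun i => by
    rw [← extendedTable_mul_apply, hY]
    rfl
  by_cases hrank : (extendedTable A.sem (T.degree d) (T.R ++ [u]) T.C).rank = T.R.length + 1
  · rw [Args.update, if_pos hrank]
    refine ⟨?_, hT.head_cols, hT.length_le, hT.chain, Or.inl ?_⟩
    · simp [hT.head_rows]
    · exact (rank_extendedTable_eq_iff _ _ _ _).1 (hrank.trans (by simp))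
  · rw [Args.update, if_neg hrank]
    refine ⟨?_, ?_, fun i => ?_, fun i hi => ?_, ?_⟩
    · simp [hT.head_rows]
    · simp [hT.head_cols]
    · by_cases hi : i.1 < T.C.length
      · simpa [List.getElem_append_left hi] using hT.length_le ⟨i, hi⟩
      · have := i.2
        simp only [List.length_append, List.length_singleton] at this
        have hii : i.1 = T.C.length := by omega
        have := hT.length_le j
        simp only [List.get_eq_getElem, hii] at this ⊢
        simp
        omega
    · simp only [List.length_append, List.length_singleton] at hi
      rw [initialSpan_columnVec_append _ _ _ (Nat.le_of_lt_succ hi)]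
      rcases Nat.lt_succ_iff_lt_or_eq.1 hi with hi | rfl
      · rw [columnVec, List.getD_append _ _ _ _ hi]
        exact hT.chain i hi
      · rw [columnVec, initialSpan_columnVec_length, List.getD_append_right _ _ _ _ le_rfl]
        simp only [Nat.sub_self, List.getD_cons_zero]
        -- If the new vector were in the span, `y` would be right at every row and the column `j` of
        -- `Y a` wrong at `u`. Their difference separates the row of `u` from those of `R`.
        intro hmem
        obtain ⟨y, hy⟩ : ∃ y, ∀ r, dotProduct (extendedRow A.sem (T.degree d) T.C r) y =
            A.sem (r ++ a :: T.C.get j) :=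
          exists_column_of_mem_span A hd hT.length_le (List.get_mem _ _) hmem
        have hnotMem := notMem_span_of_apply_ne_zero (dotRight ((fun ki => Y a ki j) - y))
          (g := fun i => extendedRow A.sem (T.degree d) T.C (T.R.get i))
          (x := extendedRow A.sem (T.degree d) T.C u)
          (fun i => by
            change dotProduct _ _ = 0
            rw [dotProduct_sub, hR]
            exact sub_eq_zero.2 (hy _).symm)
          (by
            change dotProduct _ _ ≠ 0
            rw [dotProduct_sub]
            exact sub_ne_zero.2 fun h => hne (h.trans (hy _)))
        rcases hT.rows with hrows | hzero
        · refine hrank ?_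
          have := (rank_extendedTable_eq_iff A.sem (T.degree d) (T.R ++ [u]) T.C).2
            ((linearIndependent_get_append_singleton _ T.R u).2 ⟨hrows, hnotMem⟩)
          simpa using this
        -- When `f` vanishes on all columns, the hypothesis starts at the zero vector and stays
        -- there. As it is correct at `u`, the row of `u` is zero and lies in any span.
        · refine hnotMem ?_
          rw [extendedRow_eq_zero]
          · exact zero_mem _
          · intro i
            rw [← congrFun hu i, hinit]
            have : (fun i => A.sem (T.C.get i)) = 0 := funext fun i => hzero _ (List.get_mem _ _)
            rw [this, Matrix.zero_vecMul, Pi.zero_apply]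
    · rcases hT.rows with hrows | hzero
      · exact Or.inl (hrows.append_column (degree_le_of_append d T.R _ T.C _) hR hne)
      · right
        intro c hc
        rcases List.mem_append.1 hc with hc | hc
        · exact hzero c hc
        · rw [List.mem_singleton.1 hc]
          -- The equation of the system at the row `ε` has zero left side, so the new column
          -- vanishes there too.
          obtain ⟨R', hR'⟩ := List.head?_eq_some_iff.1 hT.head_rows
          obtain ⟨i, hi⟩ := List.get_of_mem (show [] ∈ T.R by simp [hR'])
          have := hR i
          rw [hi, extendedRow_eq_zero fun i => hzero _ (List.get_mem _ _), zero_dotProduct] at this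
          exact this.symm

theorem exists_recursiveCallOn {f : List α → ℚ} {d ℓ : ℕ} {T : Args α}
    (hR : T.R.head? = some []) (hC : T.C.head? = some []) (hℓ : ¬ ℓ < T.C.length)
    {B : PFiniteAutomaton α T.C.length} (hB : IsHypothesis f (T.degree d) T.R T.C B)
    {w : List α} (hw : B.sem w ≠ f w) : ∃ T', RecursiveCallOn f d ℓ T B w T' := by
  have hinit := init_eq_of_isHypothesis hR hB
  have hspec := largestCorrectPrefixLoop_spec (f := f) B w []
    (by simpa [PFiniteAutomaton.transWordAt] using hinit)
  rw [PFiniteAutomaton.transWordAt, Matrix.vecMul_one, ← largestCorrectPrefix] at hspec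
  cases hloop : largestCorrectPrefix f T.C B w with
  | none =>
    rw [hloop] at hspec
    exact absurd (sem_eq_of_isHypothesis hC hB hspec) hw
  | some uac =>
    exact ⟨_, hℓ, hB, hw, uac.1, uac.2.1, uac.2.2, hloop, rfl⟩

theorem RecursiveCall.length_rows {f : List α → ℚ} {d ℓ : ℕ} {T T' : Args α}
    (h : RecursiveCall f d ℓ T T') : T'.R.length = T.R.length + 1 := by
  obtain ⟨B, w, -, -, -, u, a, c, -, rfl⟩ := h
  simp [Args.update]

theorem Reachable.invariant [Fintype α] {A : PFiniteAutomaton α n} {d ℓ : ℕ}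
    {T T' : Args α} (hd : A.maxDegree ≤ d) (hT : Invariant A d T)
    (h : Reachable A.sem d ℓ T T') : Invariant A d T' := by
  induction h with
  | refl => exact hT
  | tail _ h ih =>
    obtain ⟨B, w, h⟩ := h
    exact ih.recursiveCallOn hd h

theorem Returns.exists_reachable_of_none {f : List α → ℚ} {d ℓ : ℕ} {T : Args α}
    (h : Returns f d ℓ T none) : ∃ T', Reachable f d ℓ T T' ∧ ℓ < T'.C.length := by
  generalize hres : none = res at h
  induction h with
  | timeout T h => exact ⟨T, Relation.ReflTransGen.refl, h⟩
  | found => cases hres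
  | recurse T T₁ res h _ ih =>
    obtain ⟨T', hT', hlt⟩ := ih hres
    exact ⟨T', Relation.ReflTransGen.head h hT', hlt⟩

theorem Invariant.independentRows {A : PFiniteAutomaton α n} {d : ℕ} {T : Args α}
    (hT : Invariant A d T) (h0 : A.sem [] ≠ 0) :
    IndependentRows A.sem (T.degree d) T.R T.C :=
  hT.rows.resolve_right fun h => h0 (h _ (List.mem_of_mem_head? hT.head_cols))

/-- Each call adds a row, while independence and the column bound cap the number of rows. The
induction is on the remaining room. -/
theorem acc_of_invariant [Fintype α] {A : PFiniteAutomaton α n} {d ℓ : ℕ}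
    (hd : A.maxDegree ≤ d) (h0 : A.sem [] ≠ 0) (m : ℕ) :
    ∀ T : Args α, Invariant A d T →
      (d * (columnBound d n + 1) * columnBound d n + 1) * columnBound d n - T.R.length ≤ m →
      Acc (fun T₂ T₁ => RecursiveCall A.sem d ℓ T₁ T₂) T := by
  induction m with
  | zero =>
    refine fun T hT hm => ⟨_, fun T' h => ?_⟩
    have hlen := h.length_rows
    obtain ⟨B, w, h⟩ := h
    have hT' := hT.recursiveCallOn hd h
    have h1 := (hT'.independentRows h0).length_le
    have h2 := hT'.length_cols_le hd
    have h3 : (T'.degree d + 1) * T'.C.length ≤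
        (d * (columnBound d n + 1) * columnBound d n + 1) * columnBound d n := by
      unfold Args.degree
      gcongr
    omega
  | succ m ih =>
    refine fun T hT hm => ⟨_, fun T' h => ?_⟩
    have hlen := h.length_rows
    obtain ⟨B, w, h⟩ := h
    exact ih T' (hT.recursiveCallOn hd h) (by omega)

theorem EveryRunReturns.exists_returns {f : List α → ℚ} {d ℓ : ℕ} {T : Args α}
    (h : EveryRunReturns f d ℓ T) (hℓ : ∀ T', Reachable f d ℓ T T' → ¬ ℓ < T'.C.length) :
    ∃ B, Returns f d ℓ T (some B) := by
  obtain ⟨hacc, hstep⟩ := h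
  induction hacc with
  | intro T _ ih =>
    obtain ⟨⟨B, hB⟩, hrec⟩ := hstep T Relation.ReflTransGen.refl (hℓ T Relation.ReflTransGen.refl)
    by_cases hsem : ∀ w, B.sem w = f w
    · exact ⟨_, Returns.found T B (hℓ T Relation.ReflTransGen.refl) hB hsem⟩
    · obtain ⟨w, hw⟩ := not_forall.1 hsem
      obtain ⟨T', hT'⟩ := hrec B w hB hw
      have hcall : RecursiveCall f d ℓ T T' := ⟨B, w, hT'⟩
      obtain ⟨B', hB'⟩ := ih T' hcall
        (fun T'' h => hℓ T'' (Relation.ReflTransGen.head hcall h))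
        (fun T'' h => hstep T'' (Relation.ReflTransGen.head hcall h))
      exact ⟨B', Returns.recurse T T' _ hcall hB'⟩

/-- The initial vector is zero, so any hypothesis computes zero and admits no counterexample. -/
theorem not_recursiveCall_start_of_eq_zero {f : List α → ℚ} {d ℓ : ℕ} (hf : ∀ w, f w = 0)
    (T : Args α) : ¬ RecursiveCall f d ℓ (Args.start α) T := by
  rintro ⟨B, w, -, hB, hw, -⟩
  refine hw (sem_eq_of_isHypothesis rfl hB ?_)
  rw [init_eq_of_isHypothesis rfl hB]
  simp only [hf]
  exact Matrix.zero_vecMul _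

theorem Reachable.eq_start_of_eq_zero {f : List α → ℚ} {d ℓ : ℕ} (hf : ∀ w, f w = 0)
    {T : Args α} (h : Reachable f d ℓ (Args.start α) T) : T = Args.start α := by
  rcases Relation.ReflTransGen.cases_head h with rfl | ⟨T', hT', -⟩
  · rfl
  · exact absurd hT' (not_recursiveCall_start_of_eq_zero hf T')

theorem everyRunReturns_start_of_eq_zero {f : List α → ℚ} {d ℓ : ℕ} (hf : ∀ w, f w = 0) :
    EveryRunReturns f d ℓ (Args.start α) := by
  refine ⟨⟨_, fun T h => absurd h (not_recursiveCall_start_of_eq_zero hf T)⟩, fun T hT hℓ => ?_⟩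
  obtain rfl := hT.eq_start_of_eq_zero hf
  refine ⟨⟨_, fun _ => 0, fun a => ?_, rfl⟩,
    fun B w hB hw => exists_recursiveCallOn rfl rfl hℓ hB hw⟩
  rw [Matrix.mul_zero]
  ext i j
  simp [shiftedTable, hf]

theorem sem_eq_zero_of_final_eq_zero {A : PFiniteAutomaton α n} (h : A.final = 0) (w : List α) :
    A.sem w = 0 := by
  simp [PFiniteAutomaton.sem, h, dotProduct]

end PFiniteLearning

theorem mainTheorem10 {α : Type*} [Fintype α] {n : ℕ} (A : PFiniteAutomaton α n)
    (n' d : ℕ) (hn : n ≤ n') (hd : A.maxDegree ≤ d) :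
    (¬ PFiniteLearning.Returns A.sem d (PFiniteLearning.columnBound d n')
        (PFiniteLearning.Args.start α) none) ∧
    (∀ T, PFiniteLearning.Reachable A.sem d (PFiniteLearning.columnBound d n')
        (PFiniteLearning.Args.start α) T →
          T.C.length ≤ PFiniteLearning.columnBound d n') ∧
    ((A.sem [] ≠ 0 ∨ ∀ w, A.sem w = 0) →
      PFiniteLearning.EveryRunReturns A.sem d (PFiniteLearning.columnBound d n')
        (PFiniteLearning.Args.start α) ∧
      ∃ B, PFiniteLearning.Returns A.sem d (PFiniteLearning.columnBound d n')
        (PFiniteLearning.Args.start α) (some B)) := by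
  have hbound : ∀ T, PFiniteLearning.Reachable A.sem d (PFiniteLearning.columnBound d n')
      (PFiniteLearning.Args.start α) T → T.C.length ≤ PFiniteLearning.columnBound d n' := by
    intro T hT
    -- A zero final vector breaks the first step of the chain, but then `f = 0` and only the initial
    -- call occurs.
    by_cases h0 : A.final = 0
    · obtain rfl := hT.eq_start_of_eq_zero (PFiniteLearning.sem_eq_zero_of_final_eq_zero h0)
      exact PFiniteLearning.one_le_columnBound d n'
    · exact ((hT.invariant hd (PFiniteLearning.Invariant.start d h0)).length_cols_le hd).trans
        (PFiniteLearning.columnBound_mono hn)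
  refine ⟨fun h => ?_, hbound, fun h => ?_⟩
  · obtain ⟨T, hT, hlt⟩ := h.exists_reachable_of_none
    exact absurd (hbound T hT) (not_le.2 hlt)
  · have hevery : PFiniteLearning.EveryRunReturns A.sem d (PFiniteLearning.columnBound d n')
        (PFiniteLearning.Args.start α) := by
      rcases h with h | h
      · have hfinal : A.final ≠ 0 := fun h0 =>
          h (PFiniteLearning.sem_eq_zero_of_final_eq_zero h0 [])
        have hstart := PFiniteLearning.Invariant.start d hfinal
        refine ⟨PFiniteLearning.acc_of_invariant hd h _ _ hstart le_rfl, fun T hT hℓ => ?_⟩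
        have hinv := hT.invariant hd hstart
        exact ⟨(hinv.independentRows h).exists_isHypothesis, fun B w hB hw =>
          PFiniteLearning.exists_recursiveCallOn hinv.head_rows hinv.head_cols hℓ hB hw⟩
      · exact PFiniteLearning.everyRunReturns_start_of_eq_zero h
    exact ⟨hevery, hevery.exists_returns fun T hT => not_lt.2 (hbound T hT)⟩
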